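/- All logarithms are to base $2$, and $H(x)=-x\log x-(1-x)\log(1-x)$ (with $0\log 0=0$) is the binary entropy function. Graphs are finite and simple; $i_t(G)$ denotes the number of independent sets of $G$ with exactly $t$ vertices, and $K_{d,d}$ is the complete bipartite graph with both classes of size $d$. Let $d\ge 1$, $N\geq 0$ and $t$ be integers with $0\le t\le N/2$ (if $N=0$, then $2t/N$ is read as $0$ and the empty product below is $1$). (1) For every $d$-regular graph $G$ on $N$ vertices, $$i_t(G)\le 2^{\frac N2\left(H\left(\frac{2t}{N}\right)+\frac 2d\right)};$$ if $G$ is bipartite, then $$i_t(G)\le 2^{\frac N2\left(H\left(\frac{2t}{N}\right)+\frac 1d-\frac{\log e}{2d}\left(1-\frac{2t}{N}\right)^d\right)};$$ and if $G$ has a perfect matching, then $$i_t(G)\le 2^t\binom{N/2}{t}.$$ (2) Suppose that $2d$ divides $N$, and let $D$ be the disjoint union of $\frac{N}{2d}$ copies of $K_{d,d}$. Then for every real $c>1$, $$i_t(D)\ge\left(1-\frac1c\right)\binom{N/2}{t}\,2^{\frac N2\left(\frac1d-\frac cd\left(1-\frac{2t}{N}\right)^d\right)},$$ and if $t\le\frac{N}{2d}$,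 then $$i_t(D)\ge 2^t\binom{N/2}{t}\prod_{k=1}^{t-1}\left(1-\frac{2kd}{N}\right).$$ -/

import Mathlib

/-- The binary entropy function `H(x) = -x log x - (1-x) log (1-x)`, logarithms to base 2
(with the convention `0 log 0 = 0`). -/
noncomputable def entropyTwo (x : ℝ) : ℝ :=
  -x * Real.logb 2 x - (1 - x) * Real.logb 2 (1 - x)

/-- `i_t(G)`: the number of independent sets of `G` with exactly `t` vertices. -/
noncomputable def numIndepSets {V : Type*} (G : SimpleGraph V) (t : ℕ) : ℕ :=
  {s : Finset V | G.IsNIndepSet t s}.ncard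

/-- The disjoint union of `m` copies of the complete bipartite graph `K_{d,d}`:
a vertex is a pair (index of the copy, vertex of that copy). -/
def copiesKdd (m d : ℕ) : SimpleGraph (Fin m × (Fin d ⊕ Fin d)) where
  Adj x y := x.1 = y.1 ∧ (completeBipartiteGraph (Fin d) (Fin d)).Adj x.2 y.2
  symm := ⟨fun _ _ h => ⟨h.1.symm, h.2.symm⟩⟩
  loopless := ⟨fun _ h => h.2.ne rfl⟩

/-! Upper bounds: for every fugacity `l`, `i_t(G) l^t` is at most the hard-core partition function
`Z(l)`. Zhao's swap bounds `Z(l)^2` by a sum over pairs of vertex sets with no edge between them.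
That sum factors over neighbourhoods, so Finner's inequality (`sum_powerset_prod_le`) bounds it by
`(2(1+l)^d - 1)^(N/d)`. Taking `1/(1+l) = 1 - 2t/N` turns the weight of a `t`-set into the entropy
term, and `2 - q^d ≤ 2 exp(-q^d/2)` gives the sharper exponent; the `2/d` bound is a weakening of
it. With a perfect matching, an independent set is determined by the edges it meets and one endpoint
of each.

Lower bounds, with `m = N/(2d)` copies: identify the two sides of each copy. A `t`-subset of the `m
* d` resulting points lifts to `2^x` independent sets, where `x` is the number of copies it meets;
convexity of `2^x` reduces the estimate to the mean of `x`. For `t ≤ m`, it suffices to count the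
sets with at most one vertex in each copy. -/

/-! ### Hölder and Finner inequalities -/

/-- Superadditivity of the geometric mean. -/
theorem prod_rpow_inv_add_prod_rpow_inv_le {ι : Type*} (s : Finset ι) (hs : s.Nonempty)
    (a b : ι → NNReal) :
    ∏ i ∈ s, a i ^ ((s.card : ℝ)⁻¹) + ∏ i ∈ s, b i ^ ((s.card : ℝ)⁻¹)
      ≤ ∏ i ∈ s, (a i + b i) ^ ((s.card : ℝ)⁻¹) := by
  have hc : (s.card : ℝ) ≠ 0 := by exact_mod_cast hs.card_pos.ne'
  have hc' : (s.card : NNReal) ≠ 0 := by exact_mod_cast hs.card_pos.ne'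
  by_cases h : ∃ i ∈ s, a i + b i = 0
  · obtain ⟨i, hi, h0⟩ := h
    obtain ⟨ha, hb⟩ := add_eq_zero.1 h0
    have hinv : (s.card : ℝ)⁻¹ ≠ 0 := inv_ne_zero hc
    rw [Finset.prod_eq_zero hi (by rw [ha, NNReal.zero_rpow hinv]),
      Finset.prod_eq_zero hi (by rw [hb, NNReal.zero_rpow hinv])]
    simp
  · push Not at h
    have key : ∀ c : ι → NNReal,
        ∏ i ∈ s, c i ^ ((s.card : ℝ)⁻¹) ≤ (∏ i ∈ s, (a i + b i) ^ ((s.card : ℝ)⁻¹)) *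
          ∑ i ∈ s, (s.card : NNReal)⁻¹ * (c i / (a i + b i)) := by
      intro c
      have := NNReal.geom_mean_le_arith_mean_weighted s (fun _ => (s.card : NNReal)⁻¹)
        (fun i => c i / (a i + b i)) (by simp [hc'])
      refine le_trans (le_of_eq ?_) (mul_le_mul_right this _)
      rw [← Finset.prod_mul_distrib]
      refine Finset.prod_congr rfl fun i hi => ?_
      push_cast
      rw [← NNReal.mul_rpow, mul_div_cancel₀ _ (h i hi)]
    refine (add_le_add (key a) (key b)).trans (le_of_eq ?_)
    rw [← mul_add, ← Finset.sum_add_distrib]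
    have : ∑ i ∈ s, ((s.card : NNReal)⁻¹ * (a i / (a i + b i)) +
        (s.card : NNReal)⁻¹ * (b i / (a i + b i))) = 1 := by
      rw [Finset.sum_congr rfl (g := fun _ => (s.card : NNReal)⁻¹)]
      · simp [hc']
      · intro i hi
        rw [← mul_add, ← add_div, div_self (h i hi), mul_one]
    rw [this, mul_one]

/-- Hölder's inequality on a two-point space with weights `1` and `l`: the one-coordinate step of
Finner's inequality. -/
theorem prod_add_mul_prod_le_prod_rpow_inv {ι : Type*} (s : Finset ι) (hs : s.Nonempty)
    (l : NNReal) (u v : ι → NNReal) :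
    ∏ i ∈ s, u i + l * ∏ i ∈ s, v i
      ≤ ∏ i ∈ s, (u i ^ s.card + l * v i ^ s.card) ^ ((s.card : ℝ)⁻¹) := by
  have hc : s.card ≠ 0 := hs.card_pos.ne'
  refine le_trans (le_of_eq ?_) (prod_rpow_inv_add_prod_rpow_inv_le s hs
    (fun i => u i ^ s.card) (fun i => l * v i ^ s.card))
  simp only [NNReal.mul_rpow, NNReal.pow_rpow_inv_natCast _ hc, Finset.prod_mul_distrib,
    Finset.prod_const, NNReal.rpow_inv_natCast_pow _ hc]

/-- Finner's inequality for the product measure on a powerset that gives weight `l ^ #S` to `S`: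
here `f b` depends only on the trace on `M b`, and every point lies in exactly `d` of the `M b`. -/
theorem sum_powerset_prod_le {α β : Type*} [DecidableEq α] (B : Finset β) (M : β → Finset α)
    {d : ℕ} (hd : d ≠ 0) (l : NNReal) (A : Finset α)
    (hM : ∀ a ∈ A, (B.filter (fun b => a ∈ M b)).card = d) (f : β → Finset α → NNReal)
    (hf : ∀ b ∈ B, ∀ a ∈ A, a ∉ M b → ∀ S, f b (insert a S) = f b S) :
    ∑ S ∈ A.powerset, l ^ S.card * ∏ b ∈ B, f b S
      ≤ ∏ b ∈ B, (∑ T ∈ (A ∩ M b).powerset, l ^ T.card * f b T ^ d) ^ ((d : ℝ)⁻¹) := by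
  induction A using Finset.induction_on generalizing f with
  | empty =>
    simp [NNReal.pow_rpow_inv_natCast _ hd]
  | insert a A ha ih =>
    -- Integrate out the point `a`: factors that see `a` are replaced by their `L^d` norm in that
    -- coordinate, the others are unchanged.
    let g : β → Finset α → NNReal := fun b S =>
      if a ∈ M b then (f b S ^ d + l * f b (insert a S) ^ d) ^ ((d : ℝ)⁻¹) else f b S
    have hg : ∀ b ∈ B, ∀ a' ∈ A, a' ∉ M b → ∀ S, g b (insert a' S) = g b S := by
      intro b hb a' ha' hn S
      have hm := Finset.mem_insert_of_mem (b := a) ha'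
      simp only [g, Finset.insert_comm a a', hf b hb a' hm hn]
    have hih := ih (fun a' h => hM a' (Finset.mem_insert_of_mem h)) g hg
    rw [Finset.sum_powerset_insert ha, ← Finset.sum_add_distrib]
    refine le_trans (Finset.sum_le_sum fun S hS => ?_) (hih.trans (le_of_eq ?_))
    · have haS : a ∉ S := fun h => ha (Finset.mem_powerset.1 hS h)
      rw [Finset.card_insert_of_notMem haS, pow_succ, mul_assoc, ← mul_add]
      refine mul_le_mul_right ?_ _
      rw [← Finset.prod_filter_mul_prod_filter_not B (fun b => a ∈ M b) (fun b => f b S),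
        ← Finset.prod_filter_mul_prod_filter_not B (fun b => a ∈ M b) (fun b => f b (insert a S)),
        ← Finset.prod_filter_mul_prod_filter_not B (fun b => a ∈ M b) (fun b => g b S)]
      have h1 : ∏ b ∈ B.filter (fun b => a ∉ M b), f b (insert a S)
          = ∏ b ∈ B.filter (fun b => a ∉ M b), f b S :=
        Finset.prod_congr rfl fun b hb =>
          hf b (Finset.mem_filter.1 hb).1 a (Finset.mem_insert_self _ _)
            (Finset.mem_filter.1 hb).2 S
      have h2 : ∏ b ∈ B.filter (fun b => a ∉ M b), g b S
          = ∏ b ∈ B.filter (fun b => a ∉ M b), f b S :=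
        Finset.prod_congr rfl fun b hb => if_neg (Finset.mem_filter.1 hb).2
      have hcard := hM a (Finset.mem_insert_self _ _)
      have h3 : ∏ b ∈ B.filter (fun b => a ∈ M b), g b S
          = ∏ b ∈ B.filter (fun b => a ∈ M b),
            (f b S ^ d + l * f b (insert a S) ^ d) ^ ((d : ℝ)⁻¹) :=
        Finset.prod_congr rfl fun b hb => if_pos (Finset.mem_filter.1 hb).2
      have h4 := prod_add_mul_prod_le_prod_rpow_inv (B.filter (fun b => a ∈ M b))
        (Finset.card_pos.1 (by omega)) l (fun b => f b S) (fun b => f b (insert a S))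
      rw [hcard] at h4
      rw [h1, h2, h3, ← mul_assoc, ← add_mul]
      exact mul_le_mul_left h4 _
    · refine Finset.prod_congr rfl fun b hb => ?_
      congr 1
      by_cases h : a ∈ M b
      · have ha' : a ∉ A ∩ M b := fun h => ha (Finset.mem_inter.1 h).1
        rw [Finset.insert_inter_of_mem h, Finset.sum_powerset_insert ha',
          ← Finset.sum_add_distrib]
        refine Finset.sum_congr rfl fun T hT => ?_
        have haT : a ∉ T := fun h => ha' (Finset.mem_powerset.1 hT h)
        simp only [g, if_pos h, Finset.card_insert_of_notMem haT,
          NNReal.rpow_inv_natCast_pow _ hd]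
        ring
      · rw [Finset.insert_inter_of_notMem h]
        simp only [g, if_neg h]

/-- The Finner factor of one vertex is the partition function of `K_{d,d}`: only `T = ∅` leaves the
other side free. The `+ 1` avoids truncated subtraction in `NNReal`. -/
theorem sum_powerset_ite_eq_empty {α : Type*} [DecidableEq α] (s : Finset α) (l : NNReal) (d : ℕ)
    (hs : s.card = d) :
    ∑ T ∈ s.powerset, l ^ T.card * (if Disjoint s T then 1 + l else 1) ^ d + 1
      = 2 * (1 + l) ^ d := by
  have h0 : ∑ T ∈ s.powerset, l ^ T.card = (1 + l) ^ d := by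
    have := Finset.sum_pow_mul_eq_add_pow l 1 s
    simpa [hs, add_comm] using this
  rw [← Finset.add_sum_erase _ _ (Finset.empty_mem_powerset s)] at h0 ⊢
  have h1 : ∑ T ∈ s.powerset.erase ∅, l ^ T.card * (if Disjoint s T then 1 + l else 1) ^ d
      = ∑ T ∈ s.powerset.erase ∅, l ^ T.card := by
    refine Finset.sum_congr rfl fun T hT => ?_
    rw [Finset.mem_erase, Finset.mem_powerset] at hT
    rw [if_neg, one_pow, mul_one]
    intro h
    exact hT.1 (by simpa using h.mono_left hT.2)
  rw [h1, two_mul]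
  nth_rewrite 2 [← h0]
  simp
  ring

/-! ### The hard-core model and the swapping trick -/

open Classical in
/-- The hard-core partition function of `G` at fugacity `l`. -/
noncomputable def hardCore {V : Type*} [Fintype V] (G : SimpleGraph V) (l : NNReal) : NNReal :=
  ∑ S ∈ Finset.univ.filter (fun S : Finset V => G.IsIndepSet S), l ^ S.card

open Classical in
/-- The pairs of vertex sets with no edge between them. -/
noncomputable def nonadjacentPairs {V : Type*} [Fintype V] (G : SimpleGraph V) :
    Finset (Finset V × Finset V) :=
  Finset.univ.filter (fun x => ∀ u ∈ x.1, ∀ v ∈ x.2, ¬ G.Adj u v)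

/-- Zhao's bipartite swapping trick. -/
theorem hardCore_sq_le {V : Type*} [Fintype V] (G : SimpleGraph V) (l : NNReal) :
    hardCore G l ^ 2 ≤ ∑ x ∈ nonadjacentPairs G, l ^ (x.1.card + x.2.card) := by
  classical
  let Q : Finset V → Finset V → Prop := fun X A =>
    G.IsIndepSet A ∧ G.IsIndepSet (X \ A : Finset V)
  -- The choice depends only on the union `X`, which the swap preserves; hence exchanging the two
  -- sets inside `A0` is an involution.
  let A0 : Finset V → Finset V := fun X => if h : ∃ A, Q X A then h.choose else ∅
  have hA0 : ∀ S T : Finset V, G.IsIndepSet S → G.IsIndepSet T → Q (S ∪ T) (A0 (S ∪ T)) := by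
    intro S T hS hT
    have h : ∃ A, Q (S ∪ T) A := by
      refine ⟨S, hS, hT.mono ?_⟩
      intro x
      simp
      tauto
    simp only [A0, dif_pos h]
    exact h.choose_spec
  let φ : Finset V × Finset V → Finset V × Finset V := fun x =>
    ((x.1 \ A0 (x.1 ∪ x.2)) ∪ (x.2 ∩ A0 (x.1 ∪ x.2)),
      (x.2 \ A0 (x.1 ∪ x.2)) ∪ (x.1 ∩ A0 (x.1 ∪ x.2)))
  have hunion : ∀ x, (φ x).1 ∪ (φ x).2 = x.1 ∪ x.2 := by
    intro x
    ext v
    simp only [φ, Finset.mem_union, Finset.mem_sdiff, Finset.mem_inter]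
    by_cases hv : v ∈ A0 (x.1 ∪ x.2) <;> simp [hv, or_comm, and_comm]
  have hinter : ∀ x, (φ x).1 ∩ (φ x).2 = x.1 ∩ x.2 := by
    intro x
    ext v
    simp only [φ, Finset.mem_union, Finset.mem_sdiff, Finset.mem_inter]
    by_cases hv : v ∈ A0 (x.1 ∪ x.2) <;> simp [hv, or_comm, and_comm]
  have hinv : ∀ x, φ (φ x) = x := by
    intro x
    have h := hunion x
    change ((φ x).1 \ A0 ((φ x).1 ∪ (φ x).2) ∪ (φ x).2 ∩ A0 ((φ x).1 ∪ (φ x).2),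
      (φ x).2 \ A0 ((φ x).1 ∪ (φ x).2) ∪ (φ x).1 ∩ A0 ((φ x).1 ∪ (φ x).2)) = x
    rw [h]
    ext v
    all_goals
      simp only [φ, Finset.mem_union, Finset.mem_sdiff, Finset.mem_inter]
      by_cases hv : v ∈ A0 (x.1 ∪ x.2) <;> simp [hv]
  have hcard : ∀ x, (φ x).1.card + (φ x).2.card = x.1.card + x.2.card := by
    intro x
    rw [← Finset.card_union_add_card_inter, hunion, hinter, Finset.card_union_add_card_inter]
  rw [hardCore, sq, Finset.sum_mul_sum, ← Finset.sum_product']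
  simp only [← pow_add]
  set P := (Finset.univ.filter (fun S : Finset V => G.IsIndepSet S)) ×ˢ
    (Finset.univ.filter (fun S : Finset V => G.IsIndepSet S)) with hP
  have hinj : Function.Injective φ := Function.LeftInverse.injective hinv
  calc ∑ x ∈ P, l ^ (x.1.card + x.2.card)
      = ∑ x ∈ P, l ^ ((φ x).1.card + (φ x).2.card) := by simp only [hcard]
    _ = ∑ x ∈ P.image φ, l ^ (x.1.card + x.2.card) := by
        rw [Finset.sum_image (fun x _ y _ h => hinj h)]
    _ ≤ _ := by
        refine Finset.sum_le_sum_of_subset ?_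
        intro y hy
        obtain ⟨⟨S, T⟩, hx, rfl⟩ := Finset.mem_image.1 hy
        simp only [hP, Finset.mem_product, Finset.mem_filter, Finset.mem_univ, true_and] at hx
        obtain ⟨hA, hB⟩ := hA0 S T hx.1 hx.2
        simp only [nonadjacentPairs, Finset.mem_filter, Finset.mem_univ, true_and, φ]
        generalize A0 (S ∪ T) = A at hA hB
        intro u hu v hv huv
        have hS := hx.1
        have hT := hx.2
        rw [SimpleGraph.isIndepSet_iff] at hS hT hA hB
        have hne := huv.ne
        simp only [Finset.mem_union, Finset.mem_sdiff, Finset.mem_inter] at hu hv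
        -- An edge between the swapped sets would lie inside one of `(S ∪ T) \ A`, `S`, `T`, `A`,
        -- all independent.
        rcases hu with ⟨h1, h2⟩ | ⟨h1, h2⟩ <;> rcases hv with ⟨h3, h4⟩ | ⟨h3, h4⟩
        · exact hB (by simp [h1, h2]) (by simp [h3, h4]) hne huv
        · exact hS h1 h3 hne huv
        · exact hT h1 h3 hne huv
        · exact hA h2 h4 hne huv

/-- Once the first set `S` is fixed, the second ranges over all subsets of the vertices with no
neighbour in `S`. -/
theorem sum_nonadjacentPairs {V : Type*} [Fintype V] [DecidableEq V] (G : SimpleGraph V)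
    [DecidableRel G.Adj] (l : NNReal) :
    ∑ x ∈ nonadjacentPairs G, l ^ (x.1.card + x.2.card)
      = ∑ S ∈ (Finset.univ : Finset V).powerset, l ^ S.card *
        ∏ b, (if Disjoint (G.neighborFinset b) S then 1 + l else 1) := by
  classical
  rw [nonadjacentPairs, Finset.sum_filter, ← Finset.univ_product_univ, Finset.sum_product]
  simp only [Finset.powerset_univ]
  refine Finset.sum_congr rfl fun S _ => ?_
  rw [← Finset.prod_filter, Finset.prod_const, ← Finset.sum_filter]
  have h := Finset.sum_pow_mul_eq_add_pow l 1
    (Finset.univ.filter (fun b => Disjoint (G.neighborFinset b) S))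
  simp only [one_pow, mul_one] at h
  rw [add_comm 1 l, ← h, Finset.mul_sum]
  refine Finset.sum_congr ?_ fun T _ => by rw [pow_add]
  ext T
  simp only [Finset.mem_filter, Finset.mem_univ, true_and, Finset.mem_powerset,
    Finset.subset_iff, Finset.disjoint_left, SimpleGraph.mem_neighborFinset]
  constructor
  · intro h v hv u hu huS
    exact h u huS v hv hu.symm
  · intro h u hu v hv huv
    exact h hv huv.symm hu

theorem hardCore_sq_le_rpow {V : Type*} [Fintype V] (G : SimpleGraph V) [DecidableRel G.Adj]
    {d : ℕ} (hd : d ≠ 0) (hG : G.IsRegularOfDegree d) (l : NNReal) :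
    (hardCore G l : ℝ) ^ 2 ≤ (2 * (1 + (l : ℝ)) ^ d - 1) ^ ((Fintype.card V : ℝ) / d) := by
  classical
  have h1 := hardCore_sq_le G l
  rw [sum_nonadjacentPairs] at h1
  have h2 := sum_powerset_prod_le Finset.univ (fun b => G.neighborFinset b) hd l Finset.univ
    (fun a _ => by
      rw [← hG a, ← SimpleGraph.card_neighborFinset_eq_degree]
      congr 1
      ext b
      simp [SimpleGraph.adj_comm])
    (fun b S => if Disjoint (G.neighborFinset b) S then 1 + l else 1)
    (fun b _ a _ hab S => by
      simp only [Finset.disjoint_insert_right]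
      simp only [hab, not_false_eq_true, true_and])
  have h3 := h1.trans h2
  simp only [Finset.univ_inter] at h3
  set x : V → NNReal := fun b => ∑ T ∈ (G.neighborFinset b).powerset,
    l ^ T.card * (if Disjoint (G.neighborFinset b) T then 1 + l else 1) ^ d with hx
  have hxv : ∀ b, (x b : ℝ) = 2 * (1 + (l : ℝ)) ^ d - 1 := by
    intro b
    have := sum_powerset_ite_eq_empty (G.neighborFinset b) l d
      (by rw [SimpleGraph.card_neighborFinset_eq_degree, hG b])
    rw [eq_sub_iff_add_eq, ← NNReal.coe_one, ← NNReal.coe_add, this]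
    push_cast
    rfl
  have h4 : ((hardCore G l ^ 2 : NNReal) : ℝ) ≤ ((∏ b, x b ^ ((d : ℝ)⁻¹) : NNReal) : ℝ) :=
    NNReal.coe_le_coe.2 h3
  push_cast at h4
  simp only [hxv, Finset.prod_const, Finset.card_univ] at h4
  have h5 : 0 ≤ 2 * (1 + (l : ℝ)) ^ d - 1 := by
    have : (1 : ℝ) ≤ (1 + (l : ℝ)) ^ d := one_le_pow₀ (by simp)
    linarith
  rwa [← Real.rpow_mul_natCast h5, inv_mul_eq_div] at h4

/-! ### Entropy bounds for sets of fixed size -/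

open Classical in
theorem numIndepSets_eq_card {V : Type*} [Fintype V] (G : SimpleGraph V) (t : ℕ) :
    numIndepSets G t = (Finset.univ.filter (fun S : Finset V => G.IsNIndepSet t S)).card := by
  rw [numIndepSets, ← Set.ncard_coe_finset]
  simp

theorem numIndepSets_mul_pow_le_hardCore {V : Type*} [Fintype V] (G : SimpleGraph V) (t : ℕ)
    (l : NNReal) : (numIndepSets G t : ℝ) * (l : ℝ) ^ t ≤ hardCore G l := by
  classical
  have h : (numIndepSets G t : NNReal) * l ^ t ≤ hardCore G l := by
    rw [numIndepSets_eq_card, ← nsmul_eq_mul, ← Finset.sum_const, hardCore]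
    rw [Finset.sum_congr rfl (g := fun S : Finset V => l ^ S.card)
      (fun S hS => by rw [(Finset.mem_filter.1 hS).2.card_eq])]
    refine Finset.sum_le_sum_of_subset fun S hS => ?_
    simp only [Finset.mem_filter, Finset.mem_univ, true_and] at hS ⊢
    exact hS.isIndepSet
  exact_mod_cast h

/-- The substitution `q = 1/(1+l)` clears denominators. The endpoint `q = 0`, needed when `2t = N`,
corresponds to infinite fugacity and is reached by continuity. -/
theorem numIndepSets_sq_mul_le {V : Type*} [Fintype V] (G : SimpleGraph V) [DecidableRel G.Adj]
    {d : ℕ} (hd : d ≠ 0) (hG : G.IsRegularOfDegree d) {t : ℕ} (ht : 2 * t ≤ Fintype.card V)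
    {q : ℝ} (hq : q ∈ Set.Icc (0 : ℝ) 1) :
    (numIndepSets G t : ℝ) ^ 2 * ((1 - q) ^ (2 * t) * q ^ (Fintype.card V - 2 * t))
      ≤ (2 - q ^ d) ^ ((Fintype.card V : ℝ) / d) := by
  have hpos : ∀ q ∈ Set.Ioc (0 : ℝ) 1,
      (numIndepSets G t : ℝ) ^ 2 * ((1 - q) ^ (2 * t) * q ^ (Fintype.card V - 2 * t))
        ≤ (2 - q ^ d) ^ ((Fintype.card V : ℝ) / d) := by
    rintro q ⟨h0, h1⟩
    let l : NNReal := ⟨(1 - q) / q, div_nonneg (by linarith) h0.le⟩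
    have hl : (l : ℝ) = (1 - q) / q := rfl
    have ha := numIndepSets_mul_pow_le_hardCore G t l
    have hb := hardCore_sq_le_rpow G hd hG l
    have hc := (pow_le_pow_left₀ (by positivity) ha 2).trans hb
    have hqd : q ^ d ≤ 1 := pow_le_one₀ h0.le h1
    have he : 2 * (1 + (l : ℝ)) ^ d - 1 = (2 - q ^ d) / q ^ d := by
      have : 1 + (l : ℝ) = 1 / q := by
        rw [hl]
        field_simp
        ring
      rw [this, div_pow, one_pow]
      field_simp
    have hd' : (d : ℝ) ≠ 0 := by exact_mod_cast hd
    have hqn : (q ^ d) ^ ((Fintype.card V : ℝ) / d) = q ^ Fintype.card V := by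
      rw [← Real.rpow_natCast q d, ← Real.rpow_mul h0.le, mul_div_cancel₀ _ hd',
        Real.rpow_natCast]
    rw [he, Real.div_rpow (by linarith) (by positivity), hqn, le_div_iff₀ (by positivity)] at hc
    refine le_trans (le_of_eq ?_) hc
    rw [hl, mul_pow, ← pow_mul, div_pow, mul_comm t 2]
    conv_rhs => rw [← Nat.sub_add_cancel ht, pow_add q]
    field_simp
  have hcl : IsClosed {q : ℝ |
      (numIndepSets G t : ℝ) ^ 2 * ((1 - q) ^ (2 * t) * q ^ (Fintype.card V - 2 * t))
        ≤ (2 - q ^ d) ^ ((Fintype.card V : ℝ) / d)} := by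
    refine isClosed_le (by fun_prop) ?_
    exact (Real.continuous_rpow_const (by positivity)).comp (by fun_prop)
  have := hcl.closure_subset_iff.2 hpos
  rw [closure_Ioc (by norm_num)] at this
  exact this hq

/-- At `x = 0` the default `Real.logb 2 0 = 0` makes the left side `1`, which matches `0 ^ k` only
for `k = 0`. -/
theorem two_rpow_mul_logb {x : ℝ} (hx : 0 ≤ x) {k : ℕ} (h : x = 0 → k = 0) :
    (2 : ℝ) ^ ((k : ℝ) * Real.logb 2 x) = x ^ k := by
  rcases hx.eq_or_lt with h0 | h0
  · simp [h h0.symm]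
  · rw [mul_comm, Real.rpow_mul (by norm_num), Real.rpow_logb (by norm_num) (by norm_num) h0,
      Real.rpow_natCast]

theorem two_rpow_entropyTwo_mul {N t : ℕ} (ht : 2 * t ≤ N) :
    (2 : ℝ) ^ ((N : ℝ) * entropyTwo (2 * (t : ℝ) / N)) *
      ((2 * (t : ℝ) / N) ^ (2 * t) * (1 - 2 * (t : ℝ) / N) ^ (N - 2 * t)) = 1 := by
  have ht' : 2 * (t : ℝ) ≤ N := by exact_mod_cast ht
  have hp0 : 0 ≤ 2 * (t : ℝ) / N := by positivity
  have hp1 : 2 * (t : ℝ) / N ≤ 1 := div_le_one_of_le₀ ht' (by positivity)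
  have hNp : (N : ℝ) * (2 * (t : ℝ) / N) = ((2 * t : ℕ) : ℝ) := by
    rcases Nat.eq_zero_or_pos N with h | h
    · have : t = 0 := by omega
      simp [h, this]
    · push_cast
      field_simp
  rw [← two_rpow_mul_logb hp0 (k := 2 * t), ← two_rpow_mul_logb (sub_nonneg.2 hp1)
    (k := N - 2 * t), ← Real.rpow_add (by norm_num), ← Real.rpow_add (by norm_num)]
  · rw [Nat.cast_sub ht, ← hNp, entropyTwo]
    convert Real.rpow_zero 2 using 2
    ring
  · intro h
    have h1 : 2 * (t : ℝ) / N = 1 := by linarith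
    rw [h1, mul_one] at hNp
    have : N = 2 * t := by exact_mod_cast hNp
    omega
  · intro h
    rw [h, mul_zero] at hNp
    exact_mod_cast hNp.symm

/-- By the swapping trick the bound for bipartite graphs holds for all regular graphs. -/
theorem numIndepSets_le_two_rpow {V : Type*} [Fintype V] (G : SimpleGraph V) [DecidableRel G.Adj]
    {N d t : ℕ} (hN : Fintype.card V = N) (hd : d ≠ 0) (hG : G.IsRegularOfDegree d)
    (ht : 2 * t ≤ N) :
    (numIndepSets G t : ℝ) ≤
      (2 : ℝ) ^ (((N : ℝ) / 2) * (entropyTwo (2 * (t : ℝ) / N) + 1 / (d : ℝ)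
        - Real.logb 2 (Real.exp 1) / (2 * (d : ℝ)) * (1 - 2 * (t : ℝ) / N) ^ d)) := by
  have ht' : 2 * (t : ℝ) ≤ N := by exact_mod_cast ht
  have hp0 : 0 ≤ 2 * (t : ℝ) / N := by positivity
  have hp1 : 2 * (t : ℝ) / N ≤ 1 := div_le_one_of_le₀ ht' (by positivity)
  have h1 := numIndepSets_sq_mul_le G hd hG (t := t) (by rwa [hN])
    (q := 1 - 2 * (t : ℝ) / N) ⟨by linarith, by linarith⟩
  have h2 := two_rpow_entropyTwo_mul ht
  rw [hN, sub_sub_cancel] at h1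
  set p := 2 * (t : ℝ) / N
  set H := entropyTwo p
  set q := 1 - p with hq
  have hq0 : 0 ≤ q := by linarith
  have hqd : q ^ d ≤ 1 := pow_le_one₀ hq0 (by linarith)
  have h3 : 2 - q ^ d ≤ (2 : ℝ) ^ (1 - Real.logb 2 (Real.exp 1) / 2 * q ^ d) := by
    have he : (2 : ℝ) ^ (-(Real.logb 2 (Real.exp 1) / 2 * q ^ d)) = Real.exp (-(q ^ d / 2)) := by
      have : -(Real.logb 2 (Real.exp 1) / 2 * q ^ d)
          = Real.logb 2 (Real.exp 1) * (-(q ^ d / 2)) := by ring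
      rw [this, Real.rpow_mul (by norm_num),
        Real.rpow_logb (by norm_num) (by norm_num) (Real.exp_pos 1), Real.exp_one_rpow]
    rw [sub_eq_add_neg (1 : ℝ), Real.rpow_add (by norm_num), Real.rpow_one, he]
    have := Real.add_one_le_exp (-(q ^ d / 2))
    linarith
  have h4 : (2 - q ^ d) ^ ((N : ℝ) / d)
      ≤ (2 : ℝ) ^ ((1 - Real.logb 2 (Real.exp 1) / 2 * q ^ d) * ((N : ℝ) / d)) := by
    rw [Real.rpow_mul (by norm_num)]
    exact Real.rpow_le_rpow (by linarith) h3 (by positivity)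
  refine le_of_sq_le_sq ?_ (by positivity)
  calc (numIndepSets G t : ℝ) ^ 2
      = (2 : ℝ) ^ ((N : ℝ) * H) * ((numIndepSets G t : ℝ) ^ 2 *
          (p ^ (2 * t) * q ^ (N - 2 * t))) := by
        rw [mul_left_comm, h2, mul_one]
    _ ≤ (2 : ℝ) ^ ((N : ℝ) * H) *
          (2 : ℝ) ^ ((1 - Real.logb 2 (Real.exp 1) / 2 * q ^ d) * ((N : ℝ) / d)) :=
        mul_le_mul_of_nonneg_left (h1.trans h4) (by positivity)
    _ = _ := by
        rw [← Real.rpow_add (by norm_num), ← Real.rpow_mul_natCast (by norm_num)]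
        congr 1
        push_cast
        ring

theorem numIndepSets_le_two_rpow_of_regular {V : Type*} [Fintype V] (G : SimpleGraph V)
    [DecidableRel G.Adj] {N d t : ℕ} (hN : Fintype.card V = N) (hd : d ≠ 0)
    (hG : G.IsRegularOfDegree d) (ht : 2 * t ≤ N) :
    (numIndepSets G t : ℝ) ≤
      (2 : ℝ) ^ (((N : ℝ) / 2) * (entropyTwo (2 * (t : ℝ) / N) + 2 / (d : ℝ))) := by
  have ht' : 2 * (t : ℝ) ≤ N := by exact_mod_cast ht
  have hp1 : 2 * (t : ℝ) / N ≤ 1 := div_le_one_of_le₀ ht' (by positivity)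
  refine (numIndepSets_le_two_rpow G hN hd hG ht).trans
    (Real.rpow_le_rpow_of_exponent_le (by norm_num) (mul_le_mul_of_nonneg_left ?_ (by positivity)))
  have h1 : 1 / (d : ℝ) ≤ 2 / d := by gcongr; norm_num
  have h2 : 0 ≤ Real.logb 2 (Real.exp 1) :=
    Real.logb_nonneg (by norm_num) (Real.one_le_exp (by norm_num))
  have h3 : 0 ≤ Real.logb 2 (Real.exp 1) / (2 * (d : ℝ)) * (1 - 2 * (t : ℝ) / N) ^ d :=
    mul_nonneg (by positivity) (pow_nonneg (by linarith) _)
  linarith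

/-! ### Graphs with a perfect matching -/

theorem card_filter_powersetCard_involutive_le {V : Type*} [Fintype V] [DecidableEq V] (f : V → V)
    (hf : Function.Involutive f) (hne : ∀ v, f v ≠ v) (t : ℕ) :
    (Finset.univ.filter (fun S : Finset V => S.card = t ∧ ∀ v ∈ S, f v ∉ S)).card
      ≤ 2 ^ t * (Fintype.card V / 2).choose t := by
  let e : V → Sym2 V := fun v => s(v, f v)
  have he : ∀ u v, e u = e v ↔ u = v ∨ u = f v := by
    intro u v
    simp only [e, Sym2.eq_iff]
    constructor
    · tauto
    · rintro (rfl | rfl)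
      · simp
      · simp [hf v]
  let E : Finset (Sym2 V) := Finset.univ.image e
  have hE : Fintype.card V / 2 = E.card := by
    have h1 := Finset.card_eq_sum_card_image e (Finset.univ : Finset V)
    have h2 : ∀ x ∈ E, (Finset.univ.filter (fun v => e v = x)).card = 2 := by
      intro x hx
      obtain ⟨v, -, rfl⟩ := Finset.mem_image.1 hx
      have : Finset.univ.filter (fun u => e u = e v) = {v, f v} := by
        ext u
        simp [he]
      rw [this, Finset.card_pair (hne v).symm]
    rw [Finset.sum_congr rfl h2, Finset.card_univ, Finset.sum_const, smul_eq_mul] at h1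
    omega
  -- A chosen endpoint of each pair; `S` is encoded by the pairs it meets and those it meets at the
  -- chosen endpoint.
  let r : V → V := fun v => (e v).out.1
  have hr : ∀ v, r v = v ∨ r v = f v := fun v => by
    have := Sym2.out_fst_mem (e v)
    simpa [e] using this
  have hre : ∀ u v, e u = e v → r u = r v := fun u v h => by simp only [r, h]
  have hcard : ((E.powersetCard t).sigma (fun T => T.powerset)).card
      = 2 ^ t * (Fintype.card V / 2).choose t := by
    rw [Finset.card_sigma, Finset.sum_congr rfl (g := fun _ => 2 ^ t), Finset.sum_const,
      Finset.card_powersetCard, hE, smul_eq_mul, mul_comm]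
    intro T hT
    rw [Finset.card_powerset, (Finset.mem_powersetCard.1 hT).2]
  rw [← hcard]
  refine Finset.card_le_card_of_injOn
    (fun S => ⟨S.image e, (S.filter (fun v => r v = v)).image e⟩) ?_ ?_
  · intro S hS
    obtain ⟨hc, hS⟩ := (Finset.mem_filter.1 (Finset.mem_coe.1 hS)).2
    simp only [Finset.coe_sigma, Set.mem_sigma_iff, Finset.mem_coe, Finset.mem_powersetCard,
      Finset.mem_powerset]
    refine ⟨⟨Finset.image_subset_image (Finset.subset_univ _), ?_⟩,
      Finset.image_subset_image (Finset.filter_subset _ _)⟩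
    rw [Finset.card_image_of_injOn, hc]
    intro u hu v hv huv
    rcases (he u v).1 huv with h | h
    · exact h
    · exact absurd (h ▸ hu) (hS v hv)
  · have key : ∀ S : Finset V, (∀ v ∈ S, f v ∉ S) → ∀ v, v ∈ S ↔ e v ∈ S.image e ∧
        (r v = v ↔ e v ∈ (S.filter (fun v => r v = v)).image e) := by
      intro S hS v
      simp only [Finset.mem_image, Finset.mem_filter]
      constructor
      · intro hv
        refine ⟨⟨v, hv, rfl⟩, fun h => ⟨v, ⟨hv, h⟩, rfl⟩, ?_⟩
        rintro ⟨u, ⟨hu, hru⟩, huv⟩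
        rcases (he u v).1 huv with h | h
        · exact h ▸ hru
        · exact absurd (h ▸ hu) (hS v hv)
      · rintro ⟨⟨u, hu, huv⟩, hiff⟩
        rcases (he u v).1 huv with h | h
        · exact h ▸ hu
        · by_cases hrv : r v = v
          · obtain ⟨w, ⟨hw, hrw⟩, hwv⟩ := hiff.1 hrv
            have : w = v := by rw [← hrw, ← hrv]; exact hre _ _ hwv
            exact this ▸ hw
          · refine absurd (hiff.2 ⟨u, ⟨hu, ?_⟩, huv⟩) hrv
            rw [hre _ _ huv, h]
            exact (hr v).resolve_left hrv
    intro S hS S' hS' h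
    obtain ⟨-, hS⟩ := (Finset.mem_filter.1 (Finset.mem_coe.1 hS)).2
    obtain ⟨-, hS'⟩ := (Finset.mem_filter.1 (Finset.mem_coe.1 hS')).2
    simp only [Sigma.mk.injEq, heq_eq_eq] at h
    ext v
    rw [key S hS, key S' hS', h.1, h.2]

theorem numIndepSets_le_of_isPerfectMatching {V : Type*} [Fintype V] (G : SimpleGraph V)
    (M : G.Subgraph) (hM : M.IsPerfectMatching) (t : ℕ) :
    numIndepSets G t ≤ 2 ^ t * (Fintype.card V / 2).choose t := by
  classical
  have hex : ∀ v, ∃! w, M.Adj v w := SimpleGraph.Subgraph.isPerfectMatching_iff.1 hM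
  choose f hf huniq using hex
  have hinv : Function.Involutive f := fun v => (huniq (f v) v (hf v).symm).symm
  refine le_trans ?_ (card_filter_powersetCard_involutive_le f hinv (fun v => (hf v).adj_sub.ne') t)
  rw [numIndepSets_eq_card]
  refine Finset.card_le_card fun S hS => ?_
  simp only [Finset.mem_filter, Finset.mem_univ, true_and] at hS ⊢
  exact ⟨hS.card_eq, fun v hv hfv => hS.isIndepSet hv hfv (hf v).adj_sub.ne (hf v).adj_sub⟩

/-! ### Lower bounds for disjoint copies of `K_{d,d}` -/

/-- A set `W` of copies met by `T` says where to lift to the left side; the other points of `T` lift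
to the right. -/
theorem sum_two_pow_le_numIndepSets_copiesKdd (m d t : ℕ) :
    ∑ T ∈ (Finset.univ : Finset (Fin m × Fin d)).powersetCard t, 2 ^ (T.image Prod.fst).card
      ≤ numIndepSets (copiesKdd m d) t := by
  classical
  have h : ∀ T ∈ (Finset.univ : Finset (Fin m × Fin d)).powersetCard t,
      2 ^ (T.image Prod.fst).card = (T.image Prod.fst).powerset.card := by
    simp
  rw [Finset.sum_congr rfl h, ← Finset.card_sigma, numIndepSets_eq_card]
  let g : Finset (Fin m) → Fin m × Fin d → Fin m × (Fin d ⊕ Fin d) := fun W x =>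
    (x.1, if x.1 ∈ W then Sum.inl x.2 else Sum.inr x.2)
  have hg1 : ∀ W x, (g W x).1 = x.1 := fun _ _ => rfl
  have hginj : ∀ W W' x y, g W x = g W' y → x = y ∧ (x.1 ∈ W ↔ x.1 ∈ W') := by
    rintro W W' ⟨i, j⟩ ⟨i', j'⟩ h
    simp only [g, Prod.mk.injEq] at h
    obtain ⟨rfl, h⟩ := h
    by_cases h1 : i ∈ W <;> by_cases h2 : i ∈ W' <;> simp [h1, h2] at h ⊢ <;> exact h
  refine Finset.card_le_card_of_injOn (fun x => x.1.image (g x.2)) ?_ ?_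
  · rintro ⟨T, W⟩ hx
    simp only [Finset.coe_sigma, Set.mem_sigma_iff, Finset.mem_coe, Finset.mem_powersetCard] at hx
    simp only [Finset.coe_filter, Finset.mem_univ, true_and, Set.mem_ofPred_eq]
    refine ⟨?_, ?_⟩
    · intro a ha b hb _ hab
      simp only [Finset.coe_image, Set.mem_image] at ha hb
      obtain ⟨x, -, rfl⟩ := ha
      obtain ⟨y, -, rfl⟩ := hb
      obtain ⟨h1, h2⟩ := hab
      simp only [hg1] at h1
      simp only [g, h1] at h2
      by_cases h3 : y.1 ∈ W <;> simp [h3] at h2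
    · rw [Finset.card_image_of_injective _ (fun x y h => (hginj W W x y h).1), hx.1.2]
  · rintro ⟨T, W⟩ hx ⟨T', W'⟩ hx' h
    simp only [Finset.coe_sigma, Set.mem_sigma_iff, Finset.mem_coe, Finset.mem_powerset] at hx hx'
    simp only at h
    have key : ∀ (T T' : Finset (Fin m × Fin d)) (W W' : Finset (Fin m)),
        T.image (g W) = T'.image (g W') → T ⊆ T' ∧ ∀ x ∈ T, (x.1 ∈ W ↔ x.1 ∈ W') := by
      intro T T' W W' h
      have : ∀ x ∈ T, x ∈ T' ∧ (x.1 ∈ W ↔ x.1 ∈ W') := by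
        intro x hx
        have h1 := Finset.mem_image_of_mem (g W) hx
        rw [h] at h1
        obtain ⟨y, hy, hyx⟩ := Finset.mem_image.1 h1
        obtain ⟨h2, h3⟩ := hginj _ _ _ _ hyx
        subst h2
        exact ⟨hy, h3.symm⟩
      exact ⟨fun x hx => (this x hx).1, fun x hx => (this x hx).2⟩
    obtain ⟨h1, h2⟩ := key _ _ _ _ h
    obtain rfl : T = T' := h1.antisymm (key _ _ _ _ h.symm).1
    obtain rfl : W = W' := by
      ext i
      constructor
      · intro hi
        obtain ⟨x, hxT, rfl⟩ := Finset.mem_image.1 (hx.2 hi)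
        exact (h2 x hxT).1 hi
      · intro hi
        obtain ⟨x, hxT, rfl⟩ := Finset.mem_image.1 (hx'.2 hi)
        exact (h2 x hxT).2 hi
    rfl

theorem choose_mul_pow_le_numIndepSets_copiesKdd (m d t : ℕ) :
    m.choose t * (2 * d) ^ t ≤ numIndepSets (copiesKdd m d) t := by
  classical
  have hcard : (((Finset.univ : Finset (Fin m)).powersetCard t).sigma
      (fun I => I.pi (fun _ => (Finset.univ : Finset (Fin d ⊕ Fin d))))).card
        = m.choose t * (2 * d) ^ t := by
    rw [Finset.card_sigma, Finset.sum_congr rfl (g := fun _ => (2 * d) ^ t), Finset.sum_const,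
      Finset.card_powersetCard, smul_eq_mul, Finset.card_univ, Fintype.card_fin]
    intro I hI
    simp [Finset.card_pi, (Finset.mem_powersetCard.1 hI).2, two_mul]
  rw [← hcard, numIndepSets_eq_card]
  refine Finset.card_le_card_of_injOn
    (fun x => x.1.attach.image (fun i => (i.1, x.2 i.1 i.2))) ?_ ?_
  · rintro ⟨I, g⟩ hx
    simp only [Finset.coe_sigma, Set.mem_sigma_iff, Finset.mem_coe, Finset.mem_powersetCard] at hx
    simp only [Finset.coe_filter, Finset.mem_univ, true_and, Set.mem_ofPred_eq]
    refine ⟨?_, ?_⟩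
    · intro a ha b hb hne hab
      simp only [Finset.coe_image, Set.mem_image] at ha hb
      obtain ⟨⟨i, hi⟩, -, rfl⟩ := ha
      obtain ⟨⟨j, hj⟩, -, rfl⟩ := hb
      obtain rfl : i = j := hab.1
      exact hne rfl
    · rw [Finset.card_image_of_injective, Finset.card_attach, hx.1.2]
      intro i j h
      exact Subtype.ext (congrArg Prod.fst h)
  · rintro ⟨I, g⟩ - ⟨I', g'⟩ - h
    simp only at h
    have hmem : ∀ i hi, ∃ hi' : i ∈ I', g' i hi' = g i hi := by
      intro i hi
      have h1 : (i, g i hi) ∈ I.attach.image (fun i => (i.1, g i.1 i.2)) :=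
        Finset.mem_image.2 ⟨⟨i, hi⟩, Finset.mem_attach _ _, rfl⟩
      rw [h] at h1
      obtain ⟨⟨j, hj⟩, -, hji⟩ := Finset.mem_image.1 h1
      simp only [Prod.mk.injEq] at hji
      obtain ⟨rfl, hji⟩ := hji
      exact ⟨hj, hji⟩
    have hmem' : ∀ i ∈ I', i ∈ I := by
      intro i hi
      have h1 : (i, g' i hi) ∈ I'.attach.image (fun i => (i.1, g' i.1 i.2)) :=
        Finset.mem_image.2 ⟨⟨i, hi⟩, Finset.mem_attach _ _, rfl⟩
      rw [← h] at h1
      obtain ⟨⟨j, hj⟩, -, hji⟩ := Finset.mem_image.1 h1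
      simp only [Prod.mk.injEq] at hji
      exact hji.1 ▸ hj
    obtain rfl : I = I' := Finset.Subset.antisymm (fun i hi => (hmem i hi).1) hmem'
    congr 1
    funext i hi
    exact (hmem i hi).2.symm

/-- Lowering the upper index from `k + 1` to `k` multiplies the binomial by `1 - t/(k+1) ≤ 1 - t/n`.
This bounds the probability that a random `t`-set misses a given copy. -/
theorem choose_sub_mul_pow_le {n t : ℕ} (ht : t ≤ n) {d : ℕ} (hd : d ≤ n) :
    (n - d).choose t * n ^ d ≤ n.choose t * (n - t) ^ d := by
  induction d with
  | zero => simp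
  | succ d ih =>
    have ih := ih (by omega)
    obtain ⟨k, hk⟩ : ∃ k, n - d = k + 1 := ⟨n - d - 1, by omega⟩
    have hk' : n - (d + 1) = k := by omega
    have hkn : k + 1 ≤ n := by omega
    rw [hk] at ih
    rw [hk']
    have h1 := Nat.choose_mul_succ_eq k t
    have h2 : (k + 1 - t) * n ≤ (n - t) * (k + 1) := by
      rcases le_total t (k + 1) with h | h
      · zify [h, ht]
        have : (k : ℤ) + 1 ≤ n := by exact_mod_cast hkn
        nlinarith
      · simp [Nat.sub_eq_zero_of_le h]
    have h3 : k.choose t * n ≤ (k + 1).choose t * (n - t) := by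
      refine Nat.le_of_mul_le_mul_right (c := k + 1) ?_ (by omega)
      calc k.choose t * n * (k + 1) = (k.choose t * (k + 1)) * n := by ring
        _ = (k + 1).choose t * ((k + 1 - t) * n) := by rw [h1]; ring
        _ ≤ (k + 1).choose t * ((n - t) * (k + 1)) := Nat.mul_le_mul_left _ h2
        _ = _ := by ring
    calc k.choose t * n ^ (d + 1) = k.choose t * n * n ^ d := by ring
      _ ≤ (k + 1).choose t * (n - t) * n ^ d := Nat.mul_le_mul_right _ h3
      _ = (k + 1).choose t * n ^ d * (n - t) := by ring
      _ ≤ n.choose t * (n - t) ^ d * (n - t) := Nat.mul_le_mul_right _ ih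
      _ = _ := by ring

/-- The number of pairs of a `t`-set and a class of `Fin m × Fin d` that the set avoids. -/
theorem sum_card_image_fst_add (m d t : ℕ) :
    ∑ T ∈ (Finset.univ : Finset (Fin m × Fin d)).powersetCard t, (T.image Prod.fst).card
      + m * (m * d - d).choose t = m * (m * d).choose t := by
  classical
  have h1 : ∀ i : Fin m, (((Finset.univ : Finset (Fin m × Fin d)).powersetCard t).filter
      (fun T => i ∉ T.image Prod.fst)).card = (m * d - d).choose t := by
    intro i
    have : ((Finset.univ : Finset (Fin m × Fin d)).powersetCard t).filter
        (fun T => i ∉ T.image Prod.fst)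
          = (({i} ×ˢ Finset.univ : Finset (Fin m × Fin d))ᶜ).powersetCard t := by
      ext T
      simp only [Finset.mem_filter, Finset.mem_powersetCard,
        Finset.mem_image, Finset.subset_iff, Finset.mem_compl, Finset.mem_product,
        Finset.mem_singleton, Finset.mem_univ, and_true]
      constructor
      · rintro ⟨h, h'⟩
        exact ⟨fun x hx hxi => h' ⟨x, hx, hxi⟩, h.2⟩
      · rintro ⟨h, h'⟩
        exact ⟨⟨fun _ _ => trivial, h'⟩, fun ⟨x, hx, hxi⟩ => h hx hxi⟩
    rw [this, Finset.card_powersetCard, Finset.card_compl]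
    simp
  have h2 : ∀ T : Finset (Fin m × Fin d), (T.image Prod.fst).card
      + ∑ i : Fin m, (if i ∉ T.image Prod.fst then 1 else 0) = m := by
    intro T
    have : Finset.univ.filter (fun i => i ∉ T.image Prod.fst) = (T.image Prod.fst)ᶜ := by
      ext i
      simp
    rw [← Finset.card_filter, this, Finset.card_add_card_compl, Fintype.card_fin]
  have h3 : ∑ T ∈ (Finset.univ : Finset (Fin m × Fin d)).powersetCard t,
      ∑ i : Fin m, (if i ∉ T.image Prod.fst then 1 else 0) = m * (m * d - d).choose t := by
    rw [Finset.sum_comm]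
    simp only [← Finset.card_filter, h1]
    simp
  rw [← h3, ← Finset.sum_add_distrib, Finset.sum_congr rfl (fun T _ => h2 T), Finset.sum_const,
    Finset.card_powersetCard]
  simp [mul_comm]

/-- Jensen's inequality through the tangent line of `2^x` at `a`; a lower bound `a` for the mean
suffices since the slope is positive. -/
theorem card_mul_two_rpow_le_sum {ι : Type*} (s : Finset ι) (x : ι → ℕ) (a : ℝ)
    (h : s.card * a ≤ ∑ i ∈ s, (x i : ℝ)) :
    s.card * (2 : ℝ) ^ a ≤ ∑ i ∈ s, (2 : ℝ) ^ x i := by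
  have h1 : ∀ i ∈ s, (2 : ℝ) ^ a * (1 + Real.log 2 * (x i - a)) ≤ (2 : ℝ) ^ x i := by
    intro i _
    have : (2 : ℝ) ^ x i = (2 : ℝ) ^ a * Real.exp (Real.log 2 * (x i - a)) := by
      rw [← Real.rpow_def_of_pos (by norm_num), ← Real.rpow_add (by norm_num),
        add_sub_cancel, Real.rpow_natCast]
    rw [this]
    have := Real.add_one_le_exp (Real.log 2 * (x i - a))
    gcongr
    linarith
  refine le_trans ?_ (Finset.sum_le_sum h1)
  rw [← Finset.mul_sum, Finset.sum_add_distrib, ← Finset.mul_sum, Finset.sum_sub_distrib]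
  simp only [Finset.sum_const, nsmul_eq_mul, mul_one]
  have h2 : 0 ≤ Real.log 2 * (∑ i ∈ s, (x i : ℝ) - s.card * a) :=
    mul_nonneg (Real.log_nonneg (by norm_num)) (by linarith)
  rw [mul_comm]
  gcongr
  linarith

theorem choose_mul_two_rpow_le_numIndepSets_copiesKdd {m d t : ℕ} (hd : d ≠ 0)
    (ht : t ≤ m * d) :
    ((m * d).choose t : ℝ) * (2 : ℝ) ^ ((m : ℝ) * (1 - (1 - (t : ℝ) / (m * d : ℕ)) ^ d))
      ≤ numIndepSets (copiesKdd m d) t := by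
  have h0 : (∑ T ∈ (Finset.univ : Finset (Fin m × Fin d)).powersetCard t,
      (2 : ℝ) ^ (T.image Prod.fst).card) ≤ numIndepSets (copiesKdd m d) t := by
    exact_mod_cast sum_two_pow_le_numIndepSets_copiesKdd m d t
  refine le_trans ?_ h0
  have hc : (((Finset.univ : Finset (Fin m × Fin d)).powersetCard t).card : ℝ)
      = ((m * d).choose t : ℝ) := by simp
  rw [← hc]
  refine card_mul_two_rpow_le_sum _ _ _ ?_
  rw [hc]
  have h1 : (∑ T ∈ (Finset.univ : Finset (Fin m × Fin d)).powersetCard t,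
      ((T.image Prod.fst).card : ℝ)) + m * ((m * d - d).choose t : ℝ)
        = m * ((m * d).choose t : ℝ) := by
    exact_mod_cast sum_card_image_fst_add m d t
  rcases Nat.eq_zero_or_pos m with rfl | hm
  · simp only [Nat.cast_zero, zero_mul, mul_zero]
    positivity
  have hn : (0 : ℝ) < (m * d : ℕ) := by
    exact_mod_cast Nat.mul_pos hm (Nat.pos_of_ne_zero hd)
  have h2 : ((m * d - d).choose t : ℝ)
      ≤ ((m * d).choose t : ℝ) * (1 - (t : ℝ) / (m * d : ℕ)) ^ d := by
    have h3 : ((m * d - d).choose t : ℝ) * (m * d : ℕ) ^ d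
        ≤ ((m * d).choose t : ℝ) * ((m * d : ℕ) - (t : ℝ)) ^ d := by
      rw [← Nat.cast_sub ht]
      exact_mod_cast choose_sub_mul_pow_le ht (Nat.le_mul_of_pos_left d hm)
    rw [one_sub_div hn.ne', div_pow, ← mul_div_assoc, le_div_iff₀ (by positivity)]
    exact h3
  have h4 := mul_le_mul_of_nonneg_left h2 (Nat.cast_nonneg (α := ℝ) m)
  linarith

theorem cast_descFactorial_eq_pow_mul_prod {m t : ℕ} (ht : t ≤ m) :
    (m.descFactorial t : ℝ) = (m : ℝ) ^ t * ∏ k ∈ Finset.Ico 1 t, (1 - (k : ℝ) / m) := by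
  induction t with
  | zero => simp
  | succ t ih =>
    have hm : (m : ℝ) ≠ 0 := by
      have : m ≠ 0 := by omega
      exact_mod_cast this
    rw [Nat.descFactorial_succ, Nat.cast_mul, Nat.cast_sub (by omega), ih (by omega)]
    rcases Nat.eq_zero_or_pos t with rfl | h
    · simp
    · rw [Finset.prod_Ico_succ_top h, pow_succ]
      field_simp

/-- After multiplying by `t!`, the product is the falling factorial of `m` over `m^t`, and `t! * (m
* d).choose t ≤ (m * d)^t`. -/
theorem two_pow_mul_choose_mul_prod_le {m d t : ℕ} (ht : t ≤ m) :
    (2 : ℝ) ^ t * ((m * d).choose t : ℝ) * ∏ k ∈ Finset.Ico 1 t, (1 - (k : ℝ) / m)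
      ≤ (m.choose t : ℝ) * (2 * (d : ℝ)) ^ t := by
  have hf : (0 : ℝ) < t.factorial := by exact_mod_cast t.factorial_pos
  have hP : 0 ≤ ∏ k ∈ Finset.Ico 1 t, (1 - (k : ℝ) / m) := by
    refine Finset.prod_nonneg fun k hk => sub_nonneg.2 (div_le_one_of_le₀ ?_ (by positivity))
    rw [Finset.mem_Ico] at hk
    exact_mod_cast (by omega : k ≤ m)
  have h1 : (t.factorial : ℝ) * (m.choose t : ℝ) = m.descFactorial t := by
    exact_mod_cast (Nat.descFactorial_eq_factorial_mul_choose m t).symm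
  have h2 : (t.factorial : ℝ) * ((m * d).choose t : ℝ) ≤ ((m : ℝ) * d) ^ t := by
    have := Nat.descFactorial_le_pow (m * d) t
    rw [Nat.descFactorial_eq_factorial_mul_choose] at this
    exact_mod_cast this
  refine le_of_mul_le_mul_left ?_ hf
  rw [← mul_assoc (t.factorial : ℝ) (m.choose t : ℝ), h1, cast_descFactorial_eq_pow_mul_prod ht]
  calc (t.factorial : ℝ) * ((2 : ℝ) ^ t * ((m * d).choose t : ℝ) *
        ∏ k ∈ Finset.Ico 1 t, (1 - (k : ℝ) / m))
      = (2 : ℝ) ^ t * ((t.factorial : ℝ) * ((m * d).choose t : ℝ)) *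
        ∏ k ∈ Finset.Ico 1 t, (1 - (k : ℝ) / m) := by ring
    _ ≤ (2 : ℝ) ^ t * ((m : ℝ) * d) ^ t * ∏ k ∈ Finset.Ico 1 t, (1 - (k : ℝ) / m) := by gcongr
    _ = _ := by rw [mul_pow, mul_pow]; ring

theorem mainTheorem3 (N d t : ℕ) (hd : 1 ≤ d) (ht : (t : ℝ) ≤ (N : ℝ) / 2) :
    (∀ (V : Type*) [Fintype V] (G : SimpleGraph V) [DecidableRel G.Adj],
      Fintype.card V = N → G.IsRegularOfDegree d →
        ((numIndepSets G t : ℝ) ≤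
          (2 : ℝ) ^ (((N : ℝ) / 2) * (entropyTwo (2 * (t : ℝ) / N) + 2 / (d : ℝ)))) ∧
        (G.IsBipartite →
          (numIndepSets G t : ℝ) ≤
            (2 : ℝ) ^ (((N : ℝ) / 2) * (entropyTwo (2 * (t : ℝ) / N) + 1 / (d : ℝ)
              - Real.logb 2 (Real.exp 1) / (2 * (d : ℝ)) * (1 - 2 * (t : ℝ) / N) ^ d))) ∧
        ((∃ M : G.Subgraph, M.IsPerfectMatching) →
          numIndepSets G t ≤ 2 ^ t * (N / 2).choose t)) ∧
    (2 * d ∣ N →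
      (∀ c : ℝ, 1 < c →
        (1 - 1 / c) * ((N / 2).choose t : ℝ) *
            (2 : ℝ) ^ (((N : ℝ) / 2) *
              (1 / (d : ℝ) - c / (d : ℝ) * (1 - 2 * (t : ℝ) / N) ^ d))
          ≤ (numIndepSets (copiesKdd (N / (2 * d)) d) t : ℝ)) ∧
      ((t : ℝ) ≤ (N : ℝ) / (2 * (d : ℝ)) →
        (2 : ℝ) ^ t * ((N / 2).choose t : ℝ) *
            ∏ k ∈ Finset.Ico 1 t, (1 - 2 * (k : ℝ) * (d : ℝ) / N)
          ≤ (numIndepSets (copiesKdd (N / (2 * d)) d) t : ℝ))) := by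
  have ht2 : 2 * t ≤ N := by
    have : 2 * (t : ℝ) ≤ N := by linarith
    exact_mod_cast this
  have hd0 : d ≠ 0 := by omega
  refine ⟨fun V _ G _ hV hG => ⟨numIndepSets_le_two_rpow_of_regular G hV hd0 hG ht2,
    fun _ => numIndepSets_le_two_rpow G hV hd0 hG ht2, ?_⟩, ?_⟩
  · rintro ⟨M, hM⟩
    rw [← hV]
    exact numIndepSets_le_of_isPerfectMatching G M hM t
  · rintro ⟨m, rfl⟩
    have hm : 2 * d * m / (2 * d) = m := Nat.mul_div_cancel_left m (by omega)
    have hn : 2 * d * m / 2 = m * d := by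
      rw [mul_assoc, Nat.mul_div_cancel_left _ (by norm_num), mul_comm]
    have hdR : (d : ℝ) ≠ 0 := by exact_mod_cast hd0
    have hN : ((2 * d * m : ℕ) : ℝ) = 2 * ((m * d : ℕ) : ℝ) := by
      push_cast
      ring
    have ht' : t ≤ m * d := by nlinarith
    have hx : 2 * (t : ℝ) / (2 * d * m : ℕ) = (t : ℝ) / (m * d : ℕ) := by
      rw [hN, mul_div_mul_left _ _ (by norm_num)]
    rw [hm, hn]
    refine ⟨fun c hc => ?_, fun htm => ?_⟩
    -- Jensen gives the bound with `c = 1` in the exponent and no prefactor; any `c > 1` only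
    -- weakens it.
    · refine le_trans ?_ (choose_mul_two_rpow_le_numIndepSets_copiesKdd hd0 ht')
      rw [hx]
      have hy : 0 ≤ 1 - (t : ℝ) / (m * d : ℕ) :=
        sub_nonneg.2 (div_le_one_of_le₀ (by exact_mod_cast ht') (by positivity))
      have he : ((2 * d * m : ℕ) : ℝ) / 2 *
          (1 / (d : ℝ) - c / (d : ℝ) * (1 - (t : ℝ) / (m * d : ℕ)) ^ d)
            = m * (1 - c * (1 - (t : ℝ) / (m * d : ℕ)) ^ d) := by
        rw [hN, Nat.cast_mul]
        field_simp
      rw [he]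
      have hc1 : 1 - 1 / c ≤ 1 := by
        have : 0 ≤ 1 / c := by positivity
        linarith
      have hpow := pow_nonneg hy d
      have h1 : (2 : ℝ) ^ ((m : ℝ) * (1 - c * (1 - (t : ℝ) / (m * d : ℕ)) ^ d))
          ≤ (2 : ℝ) ^ ((m : ℝ) * (1 - (1 - (t : ℝ) / (m * d : ℕ)) ^ d)) := by
        refine Real.rpow_le_rpow_of_exponent_le (by norm_num)
          (mul_le_mul_of_nonneg_left ?_ (by positivity))
        nlinarith
      refine mul_le_mul ?_ h1 (by positivity) (by positivity)
      exact mul_le_of_le_one_left (by positivity) hc1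
    · have htm' : t ≤ m := by
        have : ((2 * d * m : ℕ) : ℝ) / (2 * (d : ℝ)) = m := by
          push_cast
          field_simp
        rw [this] at htm
        exact_mod_cast htm
      have hk : ∀ k : ℕ, 1 - 2 * (k : ℝ) * (d : ℝ) / (2 * d * m : ℕ) = 1 - (k : ℝ) / m := by
        intro k
        push_cast
        rw [mul_assoc, mul_assoc, mul_div_mul_left _ _ two_ne_zero, mul_comm (d : ℝ),
          mul_div_mul_right _ _ hdR]
      simp only [hk]
      refine (two_pow_mul_choose_mul_prod_le htm').trans ?_
      exact_mod_cast choose_mul_pow_le_numIndepSets_copiesKdd m d t
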